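/- Let $n\ge 1$, $N=\{1,\dots,n\}$, and let $\ell_i,r_i\in\mathbb{Z}\cup\{\pm\infty\}$ for $i\in N$. Put $\mathcal{X}=\{\mathbf{x}\in\mathbb{Z}^n:\ell_i\le x_i\le r_i\ \forall i\in N\}$ and $\overline{\mathcal{X}}=\{\mathbf{x}\in\mathbb{R}^n:\ell_i\le x_i\le r_i\ \forall i\in N\}$. A function $f:\mathcal{X}\to\mathbb{R}$ is called L$^\natural$-convex if $$f(\mathbf{x})+f(\mathbf{y})\ \ge\ f\left(\left\lceil\tfrac{\mathbf{x}+\mathbf{y}}{2}\right\rceil\right)+f\left(\left\lfloor\tfrac{\mathbf{x}+\mathbf{y}}{2}\right\rfloor\right)\qquad\text{for all }\mathbf{x},\mathbf{y}\in\mathcal{X},$$ with componentwise rounding, and its epigraph is $\mathcal{P}^f=\{(\eta,\mathbf{x})\in\mathbb{R}\times\mathcal{X}:\eta\ge f(\mathbf{x})\}$. Let $h^i:\mathcal{X}\to\mathbb{R}$ for $i\in N$, let $H(\mathbf{x},\mathbf{y})=\max_{i\in N}\{h^i(\mathbf{x})-y_i\}$ for $(\mathbf{x},\mathbf{y})\in\mathcal{X}\times\mathbb{R}^n_+$,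 and let $$\mathcal{P}^H=\{(w,\mathbf{y},\mathbf{x})\in\mathbb{R}\times\mathbb{R}^n_+\times\mathcal{X}: w\ge H(\mathbf{x},\mathbf{y})\}.$$ Put $g^j_i(\mathbf{x})=\max\{0,h^i(\mathbf{x})-h^j(\mathbf{x})\}$ for $i,j\in N$, $\mathcal{U}=\{(u_0,\mathbf{u})\in\mathbb{R}^{n+1}_+:u_0\le\sum_{i\in N}u_i\}$, and, for $(u_0,\mathbf{u})\in\mathcal{U}$, $$F_{u_0,\mathbf{u}}(\mathbf{x})=\min_{j\in N}\Big\{u_0h^j(\mathbf{x})+\sum_{i\in N}u_i\,g^j_i(\mathbf{x})\Big\}.$$ Let $\mathcal{U}'$ be the set of all $\mathbf{u}\in\mathbb{R}^n_+$ for which there are a non-empty $M\subseteq N$ and an $|M|\times|M|$ matrix $B$ with entries in $\{0,1\}$, invertible over $\mathbb{R}$, such that $(u_i)_{i\in M}=B^{-1}\mathbf{1}$ and $u_i=0$ for $i\notin M$. **Proposition.** Suppose that all $h^j$ and all $g^j_i$ ($i,j\in N$) are L$^\natural$-convex, and that $F_{u_0,\mathbf{u}}$ is L$^\natural$-convex for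 every $(u_0,\mathbf{u})\in\mathcal{U}$. Then $\mathcal{U}'$ is finite and $$\operatorname{conv}(\mathcal{P}^H)=\left\{(w,\mathbf{y},\mathbf{x})\in\mathbb{R}\times\mathbb{R}^n_+\times\overline{\mathcal{X}}:\ (w+\mathbf{u}^\top\mathbf{y},\mathbf{x})\in\operatorname{conv}(\mathcal{P}^{F_{1,\mathbf{u}}})\ \ \forall\,\mathbf{u}\in\mathcal{U}'\right\}.$$ -/

import Mathlib

noncomputable section

namespace MixedLNat

/-- The extended integers `ℤ ∪ {±∞}`. -/
abbrev ExtInt : Type := WithBot (WithTop ℤ)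

/-- The inclusion of an integer in the extended integers. -/
def ofInt (k : ℤ) : ExtInt := ((k : WithTop ℤ) : WithBot (WithTop ℤ))

/-- The inclusion of the extended integers in the extended reals. -/
def ExtInt.toEReal : ExtInt → EReal :=
  WithBot.map (WithTop.map (fun k : ℤ => (k : ℝ)))

/-- The discrete hyperrectangle `{x ∈ ℤⁿ : lo ≤ x ≤ hi}`. -/
def box {n : ℕ} (lo hi : Fin n → ExtInt) : Set (Fin n → ℤ) :=
  {x | ∀ i, lo i ≤ ofInt (x i) ∧ ofInt (x i) ≤ hi i}

/-- The continuous relaxation `{x ∈ ℝⁿ : lo ≤ x ≤ hi}` of the hyperrectangle. -/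
def boxReal {n : ℕ} (lo hi : Fin n → ExtInt) : Set (Fin n → ℝ) :=
  {x | ∀ i, (lo i).toEReal ≤ (x i : EReal) ∧ (x i : EReal) ≤ (hi i).toEReal}

/-- An integer vector as a real vector. -/
def castVec {n : ℕ} (x : Fin n → ℤ) : Fin n → ℝ := fun i => (x i : ℝ)

/-- The componentwise rounded-up midpoint `⌈(x + y) / 2⌉`. -/
def midUp {n : ℕ} (x y : Fin n → ℤ) : Fin n → ℤ := fun i => ⌈((x i : ℝ) + (y i : ℝ)) / 2⌉

/-- The componentwise rounded-down midpoint `⌊(x + y) / 2⌋`. -/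
def midDown {n : ℕ} (x y : Fin n → ℤ) : Fin n → ℤ := fun i => ⌊((x i : ℝ) + (y i : ℝ)) / 2⌋

/-- L♮-convexity of `f` on the hyperrectangle `X` (discrete midpoint convexity). The midpoints of
two points of a hyperrectangle stay in it, so only the values of `f` on `X` matter. -/
def LNatConvexOn {n : ℕ} (X : Set (Fin n → ℤ)) (f : (Fin n → ℤ) → ℝ) : Prop :=
  ∀ x ∈ X, ∀ y ∈ X, f (midUp x y) + f (midDown x y) ≤ f x + f y

/-- The epigraph of `f` over `X`, as a subset of `ℝ × ℝⁿ`. -/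
def epi {n : ℕ} (X : Set (Fin n → ℤ)) (f : (Fin n → ℤ) → ℝ) : Set (ℝ × (Fin n → ℝ)) :=
  {p | ∃ x ∈ X, p.2 = castVec x ∧ f x ≤ p.1}

/-- `H(x, y) = max_i (hⁱ(x) - y_i)`. -/
def H {n : ℕ} [NeZero n] (h : Fin n → (Fin n → ℤ) → ℝ) (x : Fin n → ℤ) (y : Fin n → ℝ) : ℝ :=
  Finset.univ.sup' Finset.univ_nonempty (fun i => h i x - y i)

/-- The epigraph of `H` over `ℝ₊ⁿ × X`, as the set of the points `(w, y, x)`. -/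
def epiH {n : ℕ} [NeZero n] (X : Set (Fin n → ℤ)) (h : Fin n → (Fin n → ℤ) → ℝ) :
    Set (ℝ × (Fin n → ℝ) × (Fin n → ℝ)) :=
  {p | (∀ i, 0 ≤ p.2.1 i) ∧ ∃ x ∈ X, p.2.2 = castVec x ∧ H h x p.2.1 ≤ p.1}

/-- `gʲᵢ(x) = max(0, hⁱ(x) - hʲ(x))`. -/
def g {n : ℕ} (h : Fin n → (Fin n → ℤ) → ℝ) (j i : Fin n) (x : Fin n → ℤ) : ℝ :=
  max 0 (h i x - h j x)

/-- The set of the `(u₀, u) ≥ 0` with `u₀ ≤ ∑ᵢ uᵢ`. -/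
def U (n : ℕ) : Set (ℝ × (Fin n → ℝ)) :=
  {p | 0 ≤ p.1 ∧ (∀ i, 0 ≤ p.2 i) ∧ p.1 ≤ ∑ i, p.2 i}

/-- `F_{u₀,u}(x) = min_j (u₀ hʲ(x) + ∑ᵢ uᵢ gʲᵢ(x))`. -/
def F {n : ℕ} [NeZero n] (h : Fin n → (Fin n → ℤ) → ℝ) (u₀ : ℝ) (u : Fin n → ℝ)
    (x : Fin n → ℤ) : ℝ :=
  Finset.univ.inf' Finset.univ_nonempty (fun j => u₀ * h j x + ∑ i, u i * g h j i x)

/-- The nonnegative vectors `u` for which there are a nonempty `M` and a 0/1 matrix `B`, with rows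
and columns indexed by `M` and invertible over `ℝ`, such that the restriction of `u` to `M` is
`B⁻¹ 1` and `u` vanishes off `M`. -/
def U' (n : ℕ) : Set (Fin n → ℝ) :=
  {u | (∀ i, 0 ≤ u i) ∧
    ∃ M : Finset (Fin n), M.Nonempty ∧
      (∃ B : Matrix M M ℝ, (∀ k l, B k l = 0 ∨ B k l = 1) ∧ IsUnit B ∧
        (fun i : M => u i) = B⁻¹.mulVec 1) ∧
      ∀ i, i ∉ M → u i = 0}

/-- The points `(w, y, x)` with `y ≥ 0`, `x` in the continuous relaxation, and
`(w + uᵀ y, x) ∈ conv (epi F_{1,u})` for all `u` in `U'`. -/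
def CP' {n : ℕ} [NeZero n] (lo hi : Fin n → ExtInt) (h : Fin n → (Fin n → ℤ) → ℝ) :
    Set (ℝ × (Fin n → ℝ) × (Fin n → ℝ)) :=
  {p | (∀ i, 0 ≤ p.2.1 i) ∧ p.2.2 ∈ boxReal lo hi ∧
    ∀ u ∈ U' n, (p.1 + ∑ i, u i * p.2.1 i, p.2.2) ∈ convexHull ℝ (epi (box lo hi) (F h 1 u))}

end MixedLNat

end

/-! The inclusion of `convexHull (epiH ...)` in `CP'` is elementary. `F h 1 u` is the optimal value
of a fractional knapsack: the maximum of `∑ αᵢ hⁱ(x)` over `0 ≤ α ≤ u`, `∑ αᵢ = 1` (`exists_greedy`,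
`sum_mul_le_minCut`). Averaging `hⁱ(x) ≤ w + yᵢ` with an optimal `α` therefore bounds it by `w +
uᵀy`, and `CP'` is convex.

For the converse, a point `x` has exactly one representation by integer points that are pairwise
adjacent (`IsRep.eq_of_adjacentSupport`), and L♮-convexity makes that representation optimal for the
convex envelope (`IsRep.exists_adjacentSupport`). One set of weights `lam` thus serves all `u` in
`U'` at once, so `∑ₖ lamₖ F(k) ≤ w + uᵀy` for each of them.

It remains to split `(w, y)` among the points `k` of the support: values `vₖ` are sought with `∑
lamₖ vₖ ≤ w` and `∑ lamₖ max(0, hⁱ(k) - vₖ) ≤ yᵢ` (`exists_split`). If there are none, a separating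
hyperplane yields multipliers `(u₀, u) ≥ 0`. After the degenerate cases are excluded and `u₀` is
scaled to 1, knapsack duality turns the separation into a violated inequality, linear in `(u, α)`.
It suffices to test such inequalities at the extreme points of the polytope `knapsacks`, and there
`u` lies in `U'` (`fst_mem_U'_of_mem_extremePoints`). -/

namespace MixedLNat

open Finset

variable {n : ℕ}

/-! ### Rounded midpoints and a potential that uncrossing decreases -/

lemma midDown_apply (x y : Fin n → ℤ) (i : Fin n) : midDown x y i = (x i + y i) / 2 := by
  unfold midDown
  rw [Int.floor_eq_iff]
  have h1 : 2 * ((x i + y i) / 2) ≤ x i + y i := by omega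
  have h2 : x i + y i < 2 * ((x i + y i) / 2) + 2 := by omega
  have h1' : (2 : ℝ) * (((x i + y i) / 2 : ℤ) : ℝ) ≤ x i + y i := by exact_mod_cast h1
  have h2' : (x i + y i : ℝ) < 2 * (((x i + y i) / 2 : ℤ) : ℝ) + 2 := by exact_mod_cast h2
  constructor <;> linarith

lemma midUp_apply (x y : Fin n → ℤ) (i : Fin n) : midUp x y i = (x i + y i + 1) / 2 := by
  unfold midUp
  rw [Int.ceil_eq_iff]
  have h1 : 2 * ((x i + y i + 1) / 2) < x i + y i + 2 := by omega
  have h2 : x i + y i ≤ 2 * ((x i + y i + 1) / 2) := by omega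
  have h1' : (2 : ℝ) * (((x i + y i + 1) / 2 : ℤ) : ℝ) < x i + y i + 2 := by exact_mod_cast h1
  have h2' : (x i + y i : ℝ) ≤ 2 * (((x i + y i + 1) / 2 : ℤ) : ℝ) := by exact_mod_cast h2
  constructor <;> linarith

lemma midUp_add_midDown (x y : Fin n → ℤ) (i : Fin n) :
    midUp x y i + midDown x y i = x i + y i := by
  rw [midUp_apply, midDown_apply]; omega

/-- Two integer points are adjacent if they are comparable and lie in a common unit cube. -/
def Adjacent (x y : Fin n → ℤ) : Prop := (∀ i, |x i - y i| ≤ 1) ∧ (x ≤ y ∨ y ≤ x)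

/-- A quadratic function which decreases strictly when two points that are not adjacent are
replaced by their rounded midpoints. -/
def quad (x : Fin n → ℤ) : ℤ := ∑ i, x i ^ 2 + ∑ i, ∑ j, (x i - x j) ^ 2

/-- For a fixed sum, a sum of two squares grows with the difference. The rounded midpoints differ by
the parity of `x i - y i`, which is at most `|x i - y i|`. -/
lemma sq_midUp_add_sq_midDown_le (x y : Fin n → ℤ) (i : Fin n) :
    midUp x y i ^ 2 + midDown x y i ^ 2 ≤ x i ^ 2 + y i ^ 2 := by
  have h := midUp_add_midDown x y i
  have hd : (midUp x y i - midDown x y i) ^ 2 ≤ (x i - y i) ^ 2 := by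
    apply sq_le_sq.2
    rw [midUp_apply, midDown_apply]
    grind
  nlinarith [congrArg (· ^ 2) h]

lemma sq_midUp_add_sq_midDown_lt (x y : Fin n → ℤ) (i : Fin n) (hi : 1 < |x i - y i|) :
    midUp x y i ^ 2 + midDown x y i ^ 2 < x i ^ 2 + y i ^ 2 := by
  have h := midUp_add_midDown x y i
  have hd : (midUp x y i - midDown x y i) ^ 2 < (x i - y i) ^ 2 := by
    apply sq_lt_sq.2
    rw [midUp_apply, midDown_apply]
    grind
  nlinarith [congrArg (· ^ 2) h]

lemma sq_sub_midUp_add_sq_sub_midDown_le (x y : Fin n → ℤ) (i j : Fin n) :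
    (midUp x y i - midUp x y j) ^ 2 + (midDown x y i - midDown x y j) ^ 2
      ≤ (x i - x j) ^ 2 + (y i - y j) ^ 2 := by
  have h : (midUp x y i - midUp x y j) + (midDown x y i - midDown x y j)
      = (x i - x j) + (y i - y j) := by
    linarith [midUp_add_midDown x y i, midUp_add_midDown x y j]
  have hd : ((midUp x y i - midUp x y j) - (midDown x y i - midDown x y j)) ^ 2
      ≤ ((x i - x j) - (y i - y j)) ^ 2 := by
    apply sq_le_sq.2
    simp only [midUp_apply, midDown_apply]
    grind
  nlinarith [congrArg (· ^ 2) h]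

/-- With opposite signs, `x i - y i` and `x j - y j` are at least 2 apart, while their parities are
at most 1 apart. -/
lemma sq_sub_midUp_add_sq_sub_midDown_lt (x y : Fin n → ℤ) (i j : Fin n) (hi : x i < y i)
    (hj : y j < x j) :
    (midUp x y i - midUp x y j) ^ 2 + (midDown x y i - midDown x y j) ^ 2
      < (x i - x j) ^ 2 + (y i - y j) ^ 2 := by
  have h : (midUp x y i - midUp x y j) + (midDown x y i - midDown x y j)
      = (x i - x j) + (y i - y j) := by
    linarith [midUp_add_midDown x y i, midUp_add_midDown x y j]
  have hd : ((midUp x y i - midUp x y j) - (midDown x y i - midDown x y j)) ^ 2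
      < ((x i - x j) - (y i - y j)) ^ 2 := by
    apply sq_lt_sq.2
    simp only [midUp_apply, midDown_apply]
    grind
  nlinarith [congrArg (· ^ 2) h]

/-- Non-adjacency has two causes: a coordinate gap above 1 makes the first sum of `quad` drop, and
incomparability makes the second one drop. -/
lemma quad_midUp_add_quad_midDown_lt {x y : Fin n → ℤ} (hxy : ¬ Adjacent x y) :
    quad (midUp x y) + quad (midDown x y) < quad x + quad y := by
  have e : ∀ a b : Fin n → ℤ, quad a + quad b =
      ∑ i, (a i ^ 2 + b i ^ 2) + ∑ i, ∑ j, ((a i - a j) ^ 2 + (b i - b j) ^ 2) := by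
    intro a b
    simp only [quad, sum_add_distrib]; ring
  rw [e, e]
  by_cases h : ∀ i, |x i - y i| ≤ 1
  · have h' : ¬ (x ≤ y ∨ y ≤ x) := fun h' => hxy ⟨h, h'⟩
    simp only [Pi.le_def, not_or, not_forall, not_le] at h'
    obtain ⟨⟨j, hj⟩, ⟨i, hi⟩⟩ := h'
    apply add_lt_add_of_le_of_lt
    · exact sum_le_sum fun i _ => sq_midUp_add_sq_midDown_le x y i
    · refine sum_lt_sum (fun i _ => sum_le_sum fun j _ =>
        sq_sub_midUp_add_sq_sub_midDown_le x y i j) ⟨i, mem_univ _, ?_⟩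
      exact sum_lt_sum (fun j _ => sq_sub_midUp_add_sq_sub_midDown_le x y i j)
        ⟨j, mem_univ _, sq_sub_midUp_add_sq_sub_midDown_lt x y i j hi hj⟩
  · push Not at h
    obtain ⟨i, hi⟩ := h
    apply add_lt_add_of_lt_of_le
    · exact sum_lt_sum (fun i _ => sq_midUp_add_sq_midDown_le x y i)
        ⟨i, mem_univ _, sq_midUp_add_sq_midDown_lt x y i hi⟩
    · exact sum_le_sum fun i _ => sum_le_sum fun j _ =>
        sq_sub_midUp_add_sq_sub_midDown_le x y i j

/-! ### Representations with adjacent support: existence and uniqueness -/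

/-- The weights `μ`, supported on the finite set `Z`, represent `x` as a convex combination. -/
structure IsRep (Z : Finset (Fin n → ℤ)) (x : Fin n → ℝ) (μ : (Fin n → ℤ) → ℝ) : Prop where
  nonneg : ∀ z, 0 ≤ μ z
  off : ∀ z, z ∉ Z → μ z = 0
  sum_one : ∑ z ∈ Z, μ z = 1
  bary : ∀ i, ∑ z ∈ Z, μ z * (z i : ℝ) = x i

/-- The support of `μ` consists of pairwise adjacent points. -/
def AdjacentSupport (μ : (Fin n → ℤ) → ℝ) : Prop :=
  ∀ z z', μ z ≠ 0 → μ z' ≠ 0 → Adjacent z z'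

lemma IsRep.sum_mul_mono {Z Z' : Finset (Fin n → ℤ)} {x : Fin n → ℝ} {μ : (Fin n → ℤ) → ℝ}
    (h : IsRep Z x μ) (hZ : Z ⊆ Z') (f : (Fin n → ℤ) → ℝ) :
    ∑ z ∈ Z', μ z * f z = ∑ z ∈ Z, μ z * f z :=
  (sum_subset hZ fun z _ hz => by rw [h.off z hz, zero_mul]).symm

lemma IsRep.mono {Z Z' : Finset (Fin n → ℤ)} {x : Fin n → ℝ} {μ : (Fin n → ℤ) → ℝ}
    (h : IsRep Z x μ) (hZ : Z ⊆ Z') : IsRep Z' x μ where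
  nonneg := h.nonneg
  off z hz := h.off z fun h' => hz (hZ h')
  sum_one := by
    have := h.sum_mul_mono hZ fun _ => 1
    simpa [h.sum_one] using this
  bary i := by rw [h.sum_mul_mono hZ, h.bary]

lemma isCompact_setOf_isRep (Z : Finset (Fin n → ℤ)) (x : Fin n → ℝ) :
    IsCompact {μ | IsRep Z x μ} := by
  classical
  have hc : IsCompact (Set.univ.pi fun z : Fin n → ℤ =>
      if z ∈ Z then Set.Icc (0 : ℝ) 1 else {0}) := by
    apply isCompact_univ_pi
    intro z
    split_ifs
    · exact isCompact_Icc
    · exact isCompact_singleton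
  have hs : ∀ φ : (Fin n → ℤ) → ℝ,
      Continuous fun μ : (Fin n → ℤ) → ℝ => ∑ z ∈ Z, μ z * φ z := fun φ => by fun_prop
  have hcl : IsClosed ({μ : (Fin n → ℤ) → ℝ | ∑ z ∈ Z, μ z * 1 = 1} ∩
      ⋂ i, {μ : (Fin n → ℤ) → ℝ | ∑ z ∈ Z, μ z * (z i : ℝ) = x i}) :=
    (isClosed_eq (hs fun _ => 1) continuous_const).inter
      (isClosed_iInter fun i => isClosed_eq (hs fun z => (z i : ℝ)) continuous_const)
  convert hc.inter_right hcl using 1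
  ext μ
  simp only [Set.mem_ofPred_eq, Set.mem_inter_iff, Set.mem_pi, Set.mem_univ, true_implies,
    Set.mem_iInter, mul_one]
  constructor
  · intro h
    refine ⟨fun z => ?_, h.sum_one, h.bary⟩
    split_ifs with hz
    · refine ⟨h.nonneg z, ?_⟩
      rw [← h.sum_one]
      exact single_le_sum (f := μ) (fun z _ => h.nonneg z) hz
    · exact h.off z hz
  · rintro ⟨h1, h2, h3⟩
    refine ⟨fun z => ?_, fun z hz => ?_, h2, h3⟩
    · have := h1 z
      split_ifs at this with hz
      · exact this.1
      · exact this.ge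
    · have := h1 z
      rwa [if_neg hz] at this

/-- Moving mass from two points to their rounded midpoints. -/
noncomputable def uncross (μ : (Fin n → ℤ) → ℝ) (ε : ℝ) (a b : Fin n → ℤ) : (Fin n → ℤ) → ℝ :=
  μ - Pi.single a ε - Pi.single b ε + Pi.single (midUp a b) ε + Pi.single (midDown a b) ε

lemma sum_uncross_mul {Z : Finset (Fin n → ℤ)} {a b : Fin n → ℤ} (ha : a ∈ Z) (hb : b ∈ Z)
    (hu : midUp a b ∈ Z) (hd : midDown a b ∈ Z) (μ φ : (Fin n → ℤ) → ℝ) (ε : ℝ) :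
    ∑ z ∈ Z, uncross μ ε a b z * φ z =
      ∑ z ∈ Z, μ z * φ z + ε * ((φ (midUp a b) + φ (midDown a b)) - (φ a + φ b)) := by
  have h : ∀ c ∈ Z, ∑ z ∈ Z, (Pi.single c ε : (Fin n → ℤ) → ℝ) z * φ z = ε * φ c := by
    intro c hc
    rw [sum_eq_single_of_mem c hc fun z _ hz => by rw [Pi.single_eq_of_ne hz, zero_mul],
      Pi.single_eq_same]
  simp only [uncross, Pi.add_apply, Pi.sub_apply, add_mul, sub_mul, sum_add_distrib,
    sum_sub_distrib, h a ha, h b hb, h _ hu, h _ hd]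
  ring

lemma IsRep.uncross {Z : Finset (Fin n → ℤ)} {x : Fin n → ℝ} {μ : (Fin n → ℤ) → ℝ}
    (h : IsRep Z x μ) {a b : Fin n → ℤ} (hab : a ≠ b) (ha : a ∈ Z) (hb : b ∈ Z)
    (hu : midUp a b ∈ Z) (hd : midDown a b ∈ Z) {ε : ℝ} (hε : 0 ≤ ε) (hεa : ε ≤ μ a)
    (hεb : ε ≤ μ b) : IsRep Z x (uncross μ ε a b) where
  nonneg z := by
    have h0 : ∀ c, 0 ≤ (Pi.single c ε : (Fin n → ℤ) → ℝ) z := fun c => by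
      rw [Pi.single_apply]
      split_ifs
      exacts [hε, le_rfl]
    have h1 : (Pi.single a ε : (Fin n → ℤ) → ℝ) z + (Pi.single b ε : (Fin n → ℤ) → ℝ) z ≤ μ z := by
      rcases eq_or_ne z a with rfl | hza
      · rwa [Pi.single_eq_same, Pi.single_eq_of_ne hab, add_zero]
      · rcases eq_or_ne z b with rfl | hzb
        · rwa [Pi.single_eq_same, Pi.single_eq_of_ne hza, zero_add]
        · rw [Pi.single_eq_of_ne hza, Pi.single_eq_of_ne hzb, zero_add]
          exact h.nonneg z
    have := h0 (midUp a b)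
    have := h0 (midDown a b)
    simp only [MixedLNat.uncross, Pi.add_apply, Pi.sub_apply]
    linarith
  off z hz := by
    have h0 : ∀ c ∈ Z, (Pi.single c ε : (Fin n → ℤ) → ℝ) z = 0 := by
      intro c hc
      exact Pi.single_eq_of_ne (ne_of_mem_of_not_mem hc hz).symm _
    simp [MixedLNat.uncross, h.off z hz, h0 _ ha, h0 _ hb, h0 _ hu, h0 _ hd]
  sum_one := by
    have := sum_uncross_mul ha hb hu hd μ (fun _ => 1) ε
    simpa [h.sum_one] using this
  bary i := by
    rw [sum_uncross_mul ha hb hu hd μ (fun z => (z i : ℝ)) ε, h.bary]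
    have : (midUp a b i : ℝ) + midDown a b i = a i + b i := by
      exact_mod_cast midUp_add_midDown a b i
    rw [this]; ring

/-- Among the representations costing no more than `ρ`, take one that minimizes the mean of `quad`.
Uncrossing a non-adjacent pair of its support would not raise the cost, by L♮-convexity, and would
lower that mean. -/
lemma IsRep.exists_adjacentSupport {Z : Finset (Fin n → ℤ)} {x : Fin n → ℝ}
    {ρ : (Fin n → ℤ) → ℝ} (hρ : IsRep Z x ρ)
    (hZ : ∀ a ∈ Z, ∀ b ∈ Z, midUp a b ∈ Z ∧ midDown a b ∈ Z) {f : (Fin n → ℤ) → ℝ}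
    (hf : LNatConvexOn (Z : Set (Fin n → ℤ)) f) :
    ∃ μ, IsRep Z x μ ∧ AdjacentSupport μ ∧ ∑ z ∈ Z, μ z * f z ≤ ∑ z ∈ Z, ρ z * f z := by
  have hs : ∀ φ : (Fin n → ℤ) → ℝ,
      Continuous fun μ : (Fin n → ℤ) → ℝ => ∑ z ∈ Z, μ z * φ z := fun φ => by fun_prop
  have hK := (isCompact_setOf_isRep Z x).inter_right
    (isClosed_le (hs f) (continuous_const (y := ∑ z ∈ Z, ρ z * f z)))
  obtain ⟨μ, ⟨hμ, hμf⟩, hmin⟩ := hK.exists_isMinOn ⟨ρ, hρ, le_refl (∑ z ∈ Z, ρ z * f z)⟩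
    (hs fun z => (quad z : ℝ)).continuousOn
  refine ⟨μ, hμ, ?_, hμf⟩
  intro a b ha hb
  by_contra hab
  have haZ : a ∈ Z := by_contra fun h => ha (hμ.off a h)
  have hbZ : b ∈ Z := by_contra fun h => hb (hμ.off b h)
  obtain ⟨hu, hd⟩ := hZ a haZ b hbZ
  have hne : a ≠ b := by
    rintro rfl
    exact hab ⟨fun i => by simp, Or.inl le_rfl⟩
  have hε : 0 < min (μ a) (μ b) :=
    lt_min ((hμ.nonneg a).lt_of_ne' ha) ((hμ.nonneg b).lt_of_ne' hb)
  have hrep := hμ.uncross hne haZ hbZ hu hd hε.le (min_le_left _ _) (min_le_right _ _)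
  have h1 := hmin (a := MixedLNat.uncross μ (min (μ a) (μ b)) a b) ⟨hrep, by
    simp only [Set.mem_ofPred_eq] at hμf ⊢
    rw [sum_uncross_mul haZ hbZ hu hd]
    have := hf a haZ b hbZ
    nlinarith⟩
  simp only [Set.mem_ofPred_eq, sum_uncross_mul haZ hbZ hu hd] at h1
  have h2 : (quad (midUp a b) : ℝ) + quad (midDown a b) < quad a + quad b := by
    exact_mod_cast quad_midUp_add_quad_midDown_lt hab
  nlinarith

/-- The difference is a mean of terms of size at most 1, and the term of `a` itself, of positive
weight, is 0. -/
lemma IsRep.abs_sub_lt_one {Z : Finset (Fin n → ℤ)} {x : Fin n → ℝ} {μ : (Fin n → ℤ) → ℝ}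
    (h : IsRep Z x μ) (hμ : AdjacentSupport μ) {a : Fin n → ℤ} (ha : μ a ≠ 0) (i : Fin n) :
    |(a i : ℝ) - x i| < 1 := by
  have haZ : a ∈ Z := by_contra fun h' => ha (h.off a h')
  have hpos : 0 < μ a := (h.nonneg a).lt_of_ne' ha
  have e : ∑ z ∈ Z, μ z * ((a i : ℝ) - z i) = a i - x i := by
    simp only [mul_sub, sum_sub_distrib, ← sum_mul, h.sum_one, h.bary, one_mul]
  rw [← e]
  have hle : ∀ z ∈ Z, |μ z * ((a i : ℝ) - z i)| ≤ μ z := by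
    intro z _
    rw [abs_mul, abs_of_nonneg (h.nonneg z)]
    by_cases hz : μ z = 0
    · simp [hz]
    · have : |(a i : ℝ) - z i| ≤ 1 := by exact_mod_cast (hμ a z ha hz).1 i
      nlinarith [h.nonneg z]
  calc |∑ z ∈ Z, μ z * ((a i : ℝ) - z i)| ≤ ∑ z ∈ Z, |μ z * ((a i : ℝ) - z i)| :=
        abs_sum_le_sum_abs _ _
    _ < ∑ z ∈ Z, μ z := sum_lt_sum hle ⟨a, haZ, by simpa using hpos⟩
    _ = 1 := h.sum_one

/-- The inequality holds weakly at each support point `z` in place of `x`, and strictly at `z = a`;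
then take the mean. Applied twice with exchanged roles, it shows that supports of two
representations cannot contain incomparable points. -/
lemma IsRep.sub_lt_sub {Z : Finset (Fin n → ℤ)} {x : Fin n → ℝ} {μ : (Fin n → ℤ) → ℝ}
    (h : IsRep Z x μ) (hμ : AdjacentSupport μ) {a b : Fin n → ℤ} (ha : μ a ≠ 0)
    (hb : ∀ k, |(b k : ℝ) - x k| < 1) {i : Fin n} (hi : b i < a i) (j : Fin n) :
    x j - a j < x i - b i := by
  have haZ : a ∈ Z := by_contra fun h' => ha (h.off a h')
  have hpos : 0 < μ a := (h.nonneg a).lt_of_ne' ha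
  have e : ∀ k, ∀ c : ℝ, x k - c = ∑ z ∈ Z, μ z * ((z k : ℝ) - c) := by
    intro k c
    simp only [mul_sub, sum_sub_distrib, ← sum_mul, h.sum_one, h.bary, one_mul]
  rw [e, e]
  have key : ∀ z, μ z ≠ 0 → z j - a j ≤ z i - b i := by
    intro z hz
    have hzx := h.abs_sub_lt_one hμ hz
    have hzb : ∀ k, |z k - b k| ≤ 1 := by
      intro k
      have h1 := abs_lt.1 (hzx k)
      have h2 := abs_lt.1 (hb k)
      have : |(z k : ℝ) - b k| < 2 := abs_lt.2 ⟨by linarith, by linarith⟩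
      have : |z k - b k| < 2 := by exact_mod_cast this
      omega
    obtain ⟨h1, h2⟩ := hμ z a hz ha
    have h1i := abs_le.1 (h1 i)
    have h1j := abs_le.1 (h1 j)
    have h3i := abs_le.1 (hzb i)
    have h3j := abs_le.1 (hzb j)
    rcases h2 with h2 | h2
    · have h4 : z i ≤ a i := h2 i
      have h5 : z j ≤ a j := h2 j
      omega
    · have h4 : a i ≤ z i := h2 i
      have h5 : a j ≤ z j := h2 j
      omega
  refine sum_lt_sum (fun z _ => ?_) ⟨a, haZ, ?_⟩
  · by_cases hz : μ z = 0
    · simp [hz]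
    · have : (z j : ℝ) - a j ≤ z i - b i := by exact_mod_cast key z hz
      exact mul_le_mul_of_nonneg_left this (h.nonneg z)
  · have : (b i : ℝ) < a i := by exact_mod_cast hi
    apply mul_lt_mul_of_pos_left _ hpos
    linarith

lemma IsRep.le_or_le {Z : Finset (Fin n → ℤ)} {x : Fin n → ℝ} {μ ν : (Fin n → ℤ) → ℝ}
    (hμ : IsRep Z x μ) (hν : IsRep Z x ν) (hμ' : AdjacentSupport μ) (hν' : AdjacentSupport ν)
    {a b : Fin n → ℤ} (ha : μ a ≠ 0) (hb : ν b ≠ 0) : a ≤ b ∨ b ≤ a := by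
  by_contra hab
  simp only [Pi.le_def, not_or, not_forall, not_le] at hab
  obtain ⟨⟨i, hi⟩, ⟨j, hj⟩⟩ := hab
  have h1 := hμ.sub_lt_sub hμ' ha (hν.abs_sub_lt_one hν' hb) hi j
  have h2 := hν.sub_lt_sub hν' hb (hμ.abs_sub_lt_one hμ' ha) hj i
  linarith

/-- The points where `μ` and `ν` differ form a chain with coordinate gaps at most 1. Such a chain is
affinely independent, which is tested at its top element. -/
lemma IsRep.eq_of_adjacentSupport {Z : Finset (Fin n → ℤ)} {x : Fin n → ℝ}
    {μ ν : (Fin n → ℤ) → ℝ} (hμ : IsRep Z x μ) (hν : IsRep Z x ν) (hμ' : AdjacentSupport μ)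
    (hν' : AdjacentSupport ν) : μ = ν := by
  classical
  by_contra hne
  set S := Z.filter fun z => μ z - ν z ≠ 0 with hS
  have hSmem : ∀ z ∈ S, μ z ≠ 0 ∨ ν z ≠ 0 := by
    intro z hz
    by_contra h
    push Not at h
    rw [hS, mem_filter, h.1, h.2] at hz
    simp at hz
  have hSx : ∀ z ∈ S, ∀ i, |(z i : ℝ) - x i| < 1 := by
    intro z hz
    rcases hSmem z hz with h | h
    · exact hμ.abs_sub_lt_one hμ' h
    · exact hν.abs_sub_lt_one hν' h
  have hSd : ∀ z ∈ S, ∀ z' ∈ S, ∀ i, z i - z' i ≤ 1 := by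
    intro z hz z' hz' i
    have h1 := abs_lt.1 (hSx z hz i)
    have h2 := abs_lt.1 (hSx z' hz' i)
    have : (z i : ℝ) - z' i < 2 := by linarith
    have : z i - z' i < 2 := by exact_mod_cast this
    omega
  have hSc : ∀ z ∈ S, ∀ z' ∈ S, z ≤ z' ∨ z' ≤ z := by
    intro z hz z' hz'
    rcases hSmem z hz with h | h <;> rcases hSmem z' hz' with h' | h'
    · exact (hμ' _ _ h h').2
    · exact hμ.le_or_le hν hμ' hν' h h'
    · exact hν.le_or_le hμ hν' hμ' h h'
    · exact (hν' _ _ h h').2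
  have hsum : ∀ φ : (Fin n → ℤ) → ℝ, ∑ z ∈ S, (μ z - ν z) * φ z =
      ∑ z ∈ Z, μ z * φ z - ∑ z ∈ Z, ν z * φ z := by
    intro φ
    rw [← sum_sub_distrib, hS, sum_filter]
    refine sum_congr rfl fun z _ => ?_
    split_ifs with h
    · ring
    · rw [not_not] at h
      linear_combination (-φ z) * h
  have hS0 : ∑ z ∈ S, (μ z - ν z) = 0 := by
    have := hsum fun _ => 1
    simpa [hμ.sum_one, hν.sum_one] using this
  have hSb : ∀ i, ∑ z ∈ S, (μ z - ν z) * (z i : ℝ) = 0 := by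
    intro i
    rw [hsum fun z => (z i : ℝ), hμ.bary, hν.bary, sub_self]
  have hSne : S.Nonempty := by
    by_contra h
    rw [not_nonempty_iff_eq_empty] at h
    apply hne
    funext z
    by_cases hz : z ∈ Z
    · by_contra h'
      have : z ∈ S := by rw [hS, mem_filter]; exact ⟨hz, sub_ne_zero.2 h'⟩
      simp [h] at this
    · rw [hμ.off z hz, hν.off z hz]
  obtain ⟨t, ht⟩ := S.exists_maximal hSne
  have htop : ∀ z ∈ S, z ≤ t := fun z hz =>
    (hSc z hz t ht.prop).elim id fun h => ht.le_of_ge hz h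
  have ht0 : μ t - ν t ≠ 0 := (mem_filter.1 ht.prop).2
  rcases (S.erase t).eq_empty_or_nonempty with he | he
  · rw [← add_sum_erase S _ ht.prop, he, sum_empty, add_zero] at hS0
    exact ht0 hS0
  · obtain ⟨s, hs⟩ := (S.erase t).exists_maximal he
    have hs' := mem_erase.1 hs.prop
    have hlt : ∃ i, s i < t i := by
      by_contra h
      push Not at h
      exact hs'.1 (le_antisymm (htop s hs'.2) h)
    obtain ⟨i, hi⟩ := hlt
    -- In a coordinate where the second largest element `s` lies below `t`, all the others are
    -- exactly one below `t`. Comparing the barycenter equation there with the mass equation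
    -- isolates the weight of `t`.
    have hz : ∀ z ∈ S.erase t, (z i : ℝ) = t i - 1 := by
      intro z hz
      have hzS := mem_of_mem_erase hz
      have h1 : z ≤ s := (hSc z hzS s hs'.2).elim id fun h => hs.le_of_ge hz h
      have h2 : z i ≤ s i := h1 i
      have h3 := hSd t ht.prop z hzS i
      have : z i = t i - 1 := by omega
      rw [this]; push_cast; ring
    have h1 := hSb i
    rw [← add_sum_erase S _ ht.prop, sum_congr rfl fun z hz' => by rw [hz z hz'],
      ← sum_mul] at h1
    rw [← add_sum_erase S _ ht.prop] at hS0
    apply ht0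
    linear_combination h1 - ((t i : ℝ) - 1) * hS0

/-! ### Fractional knapsack duality -/

/-- `min_j (a_j + ∑ᵢ uᵢ max(0, aᵢ - a_j))`. -/
noncomputable def minCut [NeZero n] (a u : Fin n → ℝ) : ℝ :=
  univ.inf' univ_nonempty fun j => a j + ∑ i, u i * max 0 (a i - a j)

lemma F_one_eq_minCut [NeZero n] (h : Fin n → (Fin n → ℤ) → ℝ) (u : Fin n → ℝ)
    (x : Fin n → ℤ) : F h 1 u x = minCut (fun i => h i x) u := by
  simp only [F, minCut, g, one_mul]

lemma minCut_le [NeZero n] (a u : Fin n → ℝ) (j : Fin n) :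
    minCut a u ≤ a j + ∑ i, u i * max 0 (a i - a j) :=
  inf'_le (fun j => a j + ∑ i, u i * max 0 (a i - a j)) (mem_univ j)

/-- Weak duality, with `v` as the multiplier of `∑ αᵢ = 1`. -/
lemma sum_mul_le_add_sum_max {a u α : Fin n → ℝ} (h0 : ∀ i, 0 ≤ α i) (h1 : ∀ i, α i ≤ u i)
    (hs : ∑ i, α i = 1) (v : ℝ) : ∑ i, α i * a i ≤ v + ∑ i, u i * max 0 (a i - v) := by
  have : ∑ i, α i * a i = v + ∑ i, α i * (a i - v) := by
    simp only [mul_sub, sum_sub_distrib, ← sum_mul, hs]; ring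
  rw [this]
  refine add_le_add le_rfl (sum_le_sum fun i _ => ?_)
  calc α i * (a i - v) ≤ α i * max 0 (a i - v) :=
        mul_le_mul_of_nonneg_left (le_max_right _ _) (h0 i)
    _ ≤ u i * max 0 (a i - v) := mul_le_mul_of_nonneg_right (h1 i) (le_max_left _ _)

lemma sum_mul_le_minCut [NeZero n] {a u α : Fin n → ℝ} (h0 : ∀ i, 0 ≤ α i)
    (h1 : ∀ i, α i ≤ u i) (hs : ∑ i, α i = 1) : ∑ i, α i * a i ≤ minCut a u :=
  le_inf' _ _ fun j _ => sum_mul_le_add_sum_max h0 h1 hs (a j)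

/-- The greedy solution of a fractional knapsack problem. -/
lemma exists_greedy [NeZero n] (a u : Fin n → ℝ) (hu : ∀ i, 0 ≤ u i) (hs : 1 ≤ ∑ i, u i) :
    ∃ (α : Fin n → ℝ) (j : Fin n), (∀ i, 0 ≤ α i) ∧ (∀ i, α i ≤ u i) ∧ ∑ i, α i = 1 ∧
      a j + ∑ i, u i * max 0 (a i - a j) = ∑ i, α i * a i := by
  classical
  -- The critical item `j` has the largest value `a j` for which the items worth at least `a j` have
  -- total capacity at least 1.
  obtain ⟨j₀, -, hj₀⟩ := exists_min_image univ a univ_nonempty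
  obtain ⟨j, hj, hmax⟩ := exists_max_image
    (univ.filter fun j => 1 ≤ ∑ i, if a j ≤ a i then u i else 0) a
    ⟨j₀, by
      rw [mem_filter]
      refine ⟨mem_univ _, hs.trans_eq (sum_congr rfl fun i _ => ?_)⟩
      rw [if_pos (hj₀ i (mem_univ _))]⟩
  rw [mem_filter] at hj
  have hlt : ∑ i, (if a j < a i then u i else 0) ≤ 1 := by
    rcases (univ.filter fun i => a j < a i).eq_empty_or_nonempty with he | he
    · rw [sum_eq_zero]
      · exact zero_le_one
      · intro i _
        rw [if_neg]
        intro h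
        have : i ∈ univ.filter fun i => a j < a i := by simpa using h
        rw [he] at this
        exact absurd this (notMem_empty i)
    · obtain ⟨k, hk, hkmin⟩ := exists_min_image _ a he
      rw [mem_filter] at hk
      by_contra hcon
      push Not at hcon
      refine absurd (hmax k ?_) (not_le.2 hk.2)
      rw [mem_filter]
      refine ⟨mem_univ _, hcon.le.trans (sum_le_sum fun i _ => ?_)⟩
      split_ifs with h1 h2 h2
      · exact le_rfl
      · exact absurd (hkmin i (by simpa using h1)) h2
      · exact hu i
      · exact le_rfl
  have hsplit : ∑ i, (if a j ≤ a i then u i else 0) =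
      ∑ i, (if a j < a i then u i else 0) + ∑ i, (if a i = a j then u i else 0) := by
    rw [← sum_add_distrib]
    refine sum_congr rfl fun i _ => ?_
    rcases lt_trichotomy (a j) (a i) with h | h | h
    · simp [h, h.le, h.ne']
    · simp [h]
    · simp [h.not_ge, h.ne, h.not_gt]
  set s := ∑ i, (if a j < a i then u i else 0) with hsdef
  set t := ∑ i, (if a i = a j then u i else 0) with htdef
  have hst : 1 ≤ s + t := hsplit ▸ hj.2
  have ht0 : 0 ≤ t := sum_nonneg fun i _ => by split_ifs; exacts [hu i, le_rfl]
  -- Items above the threshold are taken fully, and all ties at the threshold in the same fraction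
  -- `θ`.
  obtain ⟨θ, hθ0, hθ1, hθ⟩ : ∃ θ : ℝ, 0 ≤ θ ∧ θ ≤ 1 ∧ s + θ * t = 1 := by
    rcases ht0.eq_or_lt with h | h
    · exact ⟨0, le_rfl, zero_le_one, by linarith⟩
    · refine ⟨(1 - s) / t, div_nonneg (by linarith) ht0, (div_le_one h).2 (by linarith), ?_⟩
      field_simp
      ring
  refine ⟨fun i => (if a j < a i then u i else 0) + θ * (if a i = a j then u i else 0), j,
    fun i => ?_, fun i => ?_, ?_, ?_⟩
  · have := hu i
    dsimp only
    split_ifs <;> positivity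
  · have := hu i
    dsimp only
    split_ifs <;> first | linarith | nlinarith
  · rw [sum_add_distrib, ← mul_sum, hθ]
  · have e : ∀ i, ((if a j < a i then u i else 0) + θ * (if a i = a j then u i else 0)) * a i =
        ((if a j < a i then u i else 0) + θ * (if a i = a j then u i else 0)) * a j
          + u i * max 0 (a i - a j) := by
      intro i
      rcases lt_trichotomy (a j) (a i) with h | h | h
      · rw [if_pos h, if_neg h.ne', max_eq_right (by linarith)]; ring
      · simp [h]
      · rw [if_neg h.not_gt, if_neg h.ne, max_eq_left (by linarith)]; ring
    rw [sum_congr rfl fun i _ => e i, sum_add_distrib, ← sum_mul, sum_add_distrib, ← mul_sum, hθ,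
      one_mul]

/-! ### The finite set of multipliers -/

/-- Any row of `B u = 1` has entries at most 1. The bound places `(1, u)` in `U` and makes the
knapsack feasible. -/
lemma one_le_sum_of_mem_U' {u : Fin n → ℝ} (hu : u ∈ U' n) : 1 ≤ ∑ i, u i := by
  obtain ⟨h0, M, ⟨k, hk⟩, ⟨B, hB, hBu, hBe⟩, hM⟩ := hu
  have h1 : B.mulVec (fun i : M => u i) = 1 := by
    rw [hBe, Matrix.mulVec_mulVec, Matrix.mul_nonsing_inv _ ((Matrix.isUnit_iff_isUnit_det _).1 hBu),
      Matrix.one_mulVec]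
  have h2 := congrFun h1 ⟨k, hk⟩
  simp only [Matrix.mulVec, dotProduct, Pi.one_apply] at h2
  calc (1 : ℝ) = ∑ i : M, B ⟨k, hk⟩ i * u i := h2.symm
    _ ≤ ∑ i : M, u i := by
        refine sum_le_sum fun i _ => ?_
        rcases hB ⟨k, hk⟩ i with h | h <;> rw [h]
        · simpa using h0 i
        · simp
    _ = ∑ i ∈ M, u i := sum_coe_sort M u
    _ ≤ ∑ i, u i := sum_le_sum_of_subset_of_nonneg (subset_univ _) fun i _ _ => h0 i

lemma single_mem_U' (i : Fin n) : (Pi.single i 1 : Fin n → ℝ) ∈ U' n := by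
  refine ⟨fun j => ?_, {i}, singleton_nonempty i, ⟨1, fun k l => ?_, isUnit_one, ?_⟩, fun j hj => ?_⟩
  · rw [Pi.single_apply]; split_ifs <;> simp
  · rw [Matrix.one_apply]; split_ifs <;> simp
  · funext k
    have : (k : Fin n) = i := mem_singleton.1 k.2
    simp [this]
  · rw [Pi.single_eq_of_ne (by simpa using hj)]

lemma finite_U' : (U' n).Finite := by
  classical
  refine (Set.finite_range fun p : Σ M : Finset (Fin n), (M → M → Bool) => fun i : Fin n =>
    if hi : i ∈ p.1 then ((Matrix.of fun k l => if p.2 k l then (1 : ℝ) else 0)⁻¹.mulVec 1) ⟨i, hi⟩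
    else 0).subset ?_
  rintro u ⟨-, M, -, ⟨B, hB, -, hBe⟩, hM⟩
  refine ⟨⟨M, fun k l => decide (B k l = 1)⟩, ?_⟩
  have hB' : (Matrix.of fun k l : M => if decide (B k l = 1) then (1 : ℝ) else 0) = B := by
    ext k l
    rcases hB k l with h | h <;> simp [h]
  funext i
  by_cases hi : i ∈ M
  · dsimp only
    rw [dif_pos hi, hB', ← hBe]
  · dsimp only
    rw [dif_neg hi, hM i hi]

/-- A solution of 0/1 equations with right-hand side `1` which is determined by them on its
support belongs to `U'`. -/
lemma mem_U'_of_span_eq_top {u : Fin n → ℝ} (h0 : ∀ i, 0 ≤ u i) (M : Finset (Fin n))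
    (hM : M.Nonempty) (hoff : ∀ i, i ∉ M → u i = 0)
    (hspan : Submodule.span ℝ {b : M → ℝ | (∀ i, b i = 0 ∨ b i = 1) ∧ ∑ i, b i * u i = 1} = ⊤) :
    u ∈ U' n := by
  classical
  -- A basis extracted from the spanning equations supplies the rows of the invertible matrix.
  obtain ⟨b, hb, hbs, hbi⟩ := exists_linearIndependent ℝ
    {b : M → ℝ | (∀ i, b i = 0 ∨ b i = 1) ∧ ∑ i, b i * u i = 1}
  have basis : Module.Basis b ℝ (M → ℝ) := Module.Basis.mk hbi (by
    rw [Subtype.range_coe, hbs, hspan])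
  obtain ⟨e⟩ : Nonempty (M ≃ b) := ⟨(Pi.basisFun ℝ M).indexEquiv basis⟩
  let B : Matrix M M ℝ := Matrix.of fun k => (e k : M → ℝ)
  have hB : IsUnit B := by
    rw [← Matrix.linearIndependent_rows_iff_isUnit]
    exact hbi.comp e e.injective
  refine ⟨h0, M, hM, ⟨B, fun k l => (hb (e k).2).1 l, hB, ?_⟩, hoff⟩
  have h1 : B.mulVec (fun i : M => u i) = 1 := by
    funext k
    exact (hb (e k).2).2
  rw [← h1, Matrix.mulVec_mulVec, Matrix.nonsing_inv_mul _ ((Matrix.isUnit_iff_isUnit_det _).1 hB),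
    Matrix.one_mulVec]

/-! ### Extreme points of the polytope of simultaneous knapsacks -/

variable {K : Type*}

/-- The polytope of the `(u, α)` with `0 ≤ αₖ ≤ u ≤ 1` and `∑ᵢ αₖᵢ = 1` for all `k`. -/
def knapsacks (n : ℕ) (K : Type*) : Set ((Fin n → ℝ) × (K → Fin n → ℝ)) :=
  {p | (∀ i, p.1 i ≤ 1) ∧ ∀ k, (∀ i, 0 ≤ p.2 k i ∧ p.2 k i ≤ p.1 i) ∧ ∑ i, p.2 k i = 1}

lemma isCompact_knapsacks [Nonempty K] : IsCompact (knapsacks n K) := by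
  have hc : IsCompact ((Set.univ.pi fun _ : Fin n => Set.Icc (0 : ℝ) 1) ×ˢ
      (Set.univ.pi fun _ : K => Set.univ.pi fun _ : Fin n => Set.Icc (0 : ℝ) 1)) :=
    (isCompact_univ_pi fun _ => isCompact_Icc).prod
      (isCompact_univ_pi fun _ => isCompact_univ_pi fun _ => isCompact_Icc)
  refine hc.of_isClosed_subset ?_ ?_
  · simp only [knapsacks, Set.ofPred_and, Set.ofPred_forall]
    refine IsClosed.inter (isClosed_iInter fun i => isClosed_le (by fun_prop) (by fun_prop))
      (isClosed_iInter fun k => IsClosed.inter (isClosed_iInter fun i => IsClosed.inter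
        (isClosed_le (by fun_prop) (by fun_prop)) (isClosed_le (by fun_prop) (by fun_prop)))
          (isClosed_eq (by fun_prop) (by fun_prop)))
  · rintro p ⟨h1, h2⟩
    simp only [Set.mem_prod, Set.mem_pi, Set.mem_univ, true_implies, Set.mem_Icc]
    obtain ⟨k⟩ := ‹Nonempty K›
    exact ⟨fun i => ⟨((h2 k).1 i).1.trans ((h2 k).1 i).2, h1 i⟩,
      fun k i => ⟨((h2 k).1 i).1, ((h2 k).1 i).2.trans (h1 i)⟩⟩

variable [Fintype K]

/-- If `d` annihilates all 0/1 equations with right-hand side `1` satisfied by `u`, then a feasible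
point can be moved in both directions along some extension of `d`. -/
lemma exists_direction {p : (Fin n → ℝ) × (K → Fin n → ℝ)} (hp : p ∈ knapsacks n K)
    {d : Fin n → ℝ} (hd0 : ∀ i, p.1 i = 0 → d i = 0)
    (hd : ∀ S : Finset (Fin n), ∑ i ∈ S, p.1 i = 1 → ∑ i ∈ S, d i = 0) :
    ∃ β : K → Fin n → ℝ, ∀ᶠ ε : ℝ in nhds 0, p + ε • (d, β) ∈ knapsacks n K := by
  classical
  obtain ⟨h1, h2⟩ := hp
  have hβ : ∀ k, ∃ β : Fin n → ℝ, ∑ i, β i = 0 ∧ (∀ i, p.2 k i = p.1 i → β i = d i) ∧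
      ∀ i, p.2 k i = 0 → β i = 0 := by
    intro k
    set S := univ.filter fun i => p.2 k i = p.1 i with hS
    -- An item strictly between its bounds absorbs the imbalance of `d` on the tight set `S`.
    -- Without one, `p.2 k` is `p.1` on `S` and 0 elsewhere, so `S` is a 0/1 equation for `p.1` and
    -- `d` has no imbalance.
    by_cases h : ∃ j, p.2 k j ≠ 0 ∧ p.2 k j ≠ p.1 j
    · obtain ⟨j, hj0, hj1⟩ := h
      have hjS : j ∉ S := by simpa [hS] using hj1
      refine ⟨fun i => if i ∈ S then d i else if i = j then -∑ l ∈ S, d l else 0, ?_, ?_, ?_⟩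
      · rw [← sum_add_sum_compl S, sum_congr rfl fun i hi => if_pos hi,
          sum_congr rfl fun i hi => if_neg (mem_compl.1 hi), sum_ite_eq' Sᶜ,
          if_pos (mem_compl.2 hjS), add_neg_cancel]
      · intro i hi
        exact if_pos (by simpa [hS] using hi)
      · intro i hi
        dsimp only
        split_ifs with h h'
        · apply hd0
          rw [← hi]
          exact ((mem_filter.1 h).2).symm
        · exact absurd (h' ▸ hi) hj0
        · rfl
    · push Not at h
      refine ⟨fun i => if i ∈ S then d i else 0, ?_, ?_, ?_⟩
      · rw [← sum_filter, filter_mem_eq_inter, univ_inter]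
        apply hd
        rw [← (h2 k).2, sum_congr rfl fun i hi => ((mem_filter.1 hi).2).symm]
        refine sum_subset (subset_univ _) fun i _ hi => ?_
        by_contra hne
        exact hi (by simpa [hS] using h i hne)
      · intro i hi
        exact if_pos (by simpa [hS] using hi)
      · intro i hi
        dsimp only
        split_ifs with h
        · apply hd0
          rw [← hi]
          exact ((mem_filter.1 h).2).symm
        · rfl
  choose β hβ0 hβ1 hβ2 using hβ
  refine ⟨β, ?_⟩
  -- Strict inequalities survive small moves by continuity, tight ones because both sides move at
  -- the same rate.
  have key : ∀ a b s t : ℝ, a ≤ b → (a = b → s = t) →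
      ∀ᶠ ε : ℝ in nhds 0, a + ε * s ≤ b + ε * t := by
    intro a b s t hab hst
    rcases hab.eq_or_lt with h | h
    · exact Filter.Eventually.of_forall fun ε => by rw [h, hst h]
    · have hl : Filter.Tendsto (fun ε : ℝ => a + ε * s) (nhds 0) (nhds a) := by
        have : Continuous fun ε : ℝ => a + ε * s := by fun_prop
        simpa using this.tendsto 0
      have hr : Filter.Tendsto (fun ε : ℝ => b + ε * t) (nhds 0) (nhds b) := by
        have : Continuous fun ε : ℝ => b + ε * t := by fun_prop
        simpa using this.tendsto 0
      exact (hl.eventually_lt hr h).mono fun _ h => h.le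
  have e1 : ∀ᶠ ε : ℝ in nhds 0, ∀ i, p.1 i + ε * d i ≤ 1 + ε * 0 :=
    Filter.eventually_all.2 fun i => key _ _ _ _ (h1 i) fun h => by simpa using hd {i} (by simpa using h)
  have e2 : ∀ᶠ ε : ℝ in nhds 0, ∀ k i, 0 + ε * 0 ≤ p.2 k i + ε * β k i :=
    Filter.eventually_all.2 fun k => Filter.eventually_all.2 fun i =>
      key _ _ _ _ ((h2 k).1 i).1 fun h => (hβ2 k i h.symm).symm
  have e3 : ∀ᶠ ε : ℝ in nhds 0, ∀ k i, p.2 k i + ε * β k i ≤ p.1 i + ε * d i :=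
    Filter.eventually_all.2 fun k => Filter.eventually_all.2 fun i =>
      key _ _ _ _ ((h2 k).1 i).2 fun h => hβ1 k i h
  filter_upwards [e1, e2, e3] with ε h1' h2' h3'
  refine ⟨fun i => by simpa using h1' i, fun k => ⟨fun i => ⟨by simpa using h2' k i,
    by simpa using h3' k i⟩, ?_⟩⟩
  simp [sum_add_distrib, ← mul_sum, hβ0, (h2 k).2]

/-- If the 0/1 equations on the support of `p.1` did not span, a nonzero functional would vanish on
them. Its coefficients, extended by 0, give a direction along which `p` moves both ways, against
extremality. -/
lemma fst_mem_U'_of_mem_extremePoints [Nonempty K] {p : (Fin n → ℝ) × (K → Fin n → ℝ)}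
    (hp : p ∈ (knapsacks n K).extremePoints ℝ) : p.1 ∈ U' n := by
  classical
  obtain ⟨hpQ, hext⟩ := hp
  obtain ⟨h1, h2⟩ := id hpQ
  obtain ⟨k₀⟩ := id ‹Nonempty K›
  have h0 : ∀ i, 0 ≤ p.1 i := fun i => ((h2 k₀).1 i).1.trans ((h2 k₀).1 i).2
  refine mem_U'_of_span_eq_top h0 (univ.filter fun i => p.1 i ≠ 0) ?_
    (fun i hi => by simpa using hi) ?_
  · by_contra h
    rw [not_nonempty_iff_eq_empty, filter_eq_empty_iff] at h
    have : ∑ i, p.2 k₀ i = 0 := sum_eq_zero fun i hi =>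
      le_antisymm (((h2 k₀).1 i).2.trans_eq (not_not.1 (h hi))) ((h2 k₀).1 i).1
    linarith [(h2 k₀).2]
  · by_contra hspan
    set M := univ.filter fun i => p.1 i ≠ 0 with hM
    obtain ⟨f, hf0, hf⟩ := Submodule.exists_le_ker_of_lt_top _ (lt_top_iff_ne_top.2 hspan)
    let d : Fin n → ℝ := fun i => if hi : i ∈ M then f (Pi.single ⟨i, hi⟩ 1) else 0
    have hdM : ∀ i : M, d i = f (Pi.single i 1) := fun i => dif_pos i.2
    have hfd : ∀ b : M → ℝ, f b = ∑ i, b i * d i := by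
      intro b
      rw [LinearMap.pi_apply_eq_sum_univ f b]
      refine sum_congr rfl fun i _ => ?_
      rw [hdM, smul_eq_mul]
      congr 2
      funext j
      simp [Pi.single_apply, eq_comm]
    have hd0 : ∀ i, p.1 i = 0 → d i = 0 := fun i hi => dif_neg (by simpa [hM] using hi)
    have hres : ∀ (S : Finset (Fin n)) (φ : Fin n → ℝ), (∀ i, p.1 i = 0 → φ i = 0) →
        ∑ i : M, (if (i : Fin n) ∈ S then (1 : ℝ) else 0) * φ i = ∑ i ∈ S, φ i := by
      intro S φ hφ
      rw [sum_coe_sort M fun i => (if i ∈ S then (1 : ℝ) else 0) * φ i]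
      simp only [ite_mul, one_mul, zero_mul]
      rw [← sum_filter, filter_mem_eq_inter]
      refine sum_subset inter_subset_right fun i hi hi' => hφ i ?_
      by_contra h
      exact hi' (mem_inter.2 ⟨by simpa [hM] using h, hi⟩)
    have hd : ∀ S : Finset (Fin n), ∑ i ∈ S, p.1 i = 1 → ∑ i ∈ S, d i = 0 := by
      intro S hS
      have : (fun i : M => if (i : Fin n) ∈ S then (1 : ℝ) else 0) ∈ LinearMap.ker f :=
        hf (Submodule.subset_span ⟨fun i => by dsimp only; split_ifs <;> simp,
          (hres S p.1 fun i hi => hi).trans hS⟩)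
      rw [LinearMap.mem_ker, hfd, hres S d hd0] at this
      exact this
    obtain ⟨β, hβ⟩ := exists_direction hpQ hd0 hd
    have hβ' : ∀ᶠ ε : ℝ in nhds 0, p + (-ε) • (d, β) ∈ knapsacks n K := by
      have : Filter.Tendsto (fun ε : ℝ => -ε) (nhds 0) (nhds 0) := by
        simpa using (continuous_neg (G := ℝ)).tendsto 0
      exact this.eventually hβ
    obtain ⟨δ, hδ, hball⟩ := Metric.eventually_nhds_iff.1 (hβ.and hβ')
    have hε := hball (y := δ / 2) (by rw [Real.dist_eq, sub_zero, abs_of_pos] <;> linarith)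
    have heq := hext hε.1 hε.2 (by
      refine ⟨1 / 2, 1 / 2, by norm_num, by norm_num, by norm_num, ?_⟩
      module)
    apply hf0
    have hdz : ∀ i, d i = 0 := by
      intro i
      have := congrFun (congrArg Prod.fst heq) i
      simp at this
      rcases this with h | h
      · linarith
      · exact h
    ext i
    simp [← hdM, hdz]

/-- The maximizers of `l` form a compact exposed face, which has an extreme point; that point is
extreme in `s` too. -/
lemma le_of_forall_extremePoints_le {E : Type*} [AddCommGroup E] [Module ℝ E] [TopologicalSpace E]
    [T2Space E] [IsTopologicalAddGroup E] [ContinuousSMul ℝ E] [LocallyConvexSpace ℝ E] {s : Set E}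
    (hs : IsCompact s) (l : E →L[ℝ] ℝ) {c : ℝ} (h : ∀ x ∈ s.extremePoints ℝ, l x ≤ c) :
    ∀ x ∈ s, l x ≤ c := by
  intro x hx
  have he : IsExposed ℝ s {y ∈ s | ∀ z ∈ s, l z ≤ l y} := fun _ => ⟨l, rfl⟩
  obtain ⟨z, hzA, hz⟩ := hs.exists_isMaxOn ⟨x, hx⟩ l.continuous.continuousOn
  obtain ⟨y, hy⟩ := (he.isCompact hs).extremePoints_nonempty ⟨z, hzA, hz⟩
  exact (hy.1.2 x hx).trans (h y (he.isExtreme.extremePoints_subset_extremePoints hy))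

/-- Inequalities for the vectors of `U'` imply the inequalities for all multipliers. -/
lemma sum_sum_mul_le_of_forall_mem_U' [NeZero n] [Nonempty K] {lam : K → ℝ}
    (hl : ∀ k, 0 ≤ lam k) {a : K → Fin n → ℝ} {w : ℝ} {y : Fin n → ℝ} (hy : ∀ i, 0 ≤ y i)
    (hU : ∀ u ∈ U' n, ∑ k, lam k * minCut (a k) u ≤ w + ∑ i, u i * y i)
    {u : Fin n → ℝ} {α : K → Fin n → ℝ} (h0 : ∀ k i, 0 ≤ α k i) (h1 : ∀ k i, α k i ≤ u i)
    (hs : ∀ k, ∑ i, α k i = 1) :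
    ∑ k, lam k * ∑ i, α k i * a k i ≤ w + ∑ i, u i * y i := by
  let l₀ : ((Fin n → ℝ) × (K → Fin n → ℝ)) →ₗ[ℝ] ℝ :=
    { toFun := fun p => ∑ k, lam k * ∑ i, p.2 k i * a k i - ∑ i, p.1 i * y i
      map_add' := by
        intro p q
        simp only [Prod.fst_add, Prod.snd_add, Pi.add_apply, add_mul, mul_add, sum_add_distrib]
        ring
      map_smul' := by
        intro c p
        simp only [Prod.smul_fst, Prod.smul_snd, Pi.smul_apply, smul_eq_mul, RingHom.id_apply,
          mul_sub, mul_sum]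
        congr 1
        · exact sum_congr rfl fun k _ => sum_congr rfl fun i _ => by ring
        · exact sum_congr rfl fun i _ => by ring }
  let l : ((Fin n → ℝ) × (K → Fin n → ℝ)) →L[ℝ] ℝ := LinearMap.toContinuousLinearMap l₀
  have hext : ∀ p ∈ (knapsacks n K).extremePoints ℝ, l p ≤ w := by
    intro p hp
    have h2 := hU p.1 (fst_mem_U'_of_mem_extremePoints hp)
    have h3 : ∑ k, lam k * ∑ i, p.2 k i * a k i ≤ ∑ k, lam k * minCut (a k) p.1 := by
      refine sum_le_sum fun k _ => mul_le_mul_of_nonneg_left ?_ (hl k)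
      exact sum_mul_le_minCut (fun i => ((hp.1.2 k).1 i).1) (fun i => ((hp.1.2 k).1 i).2)
        (hp.1.2 k).2
    change ∑ k, lam k * ∑ i, p.2 k i * a k i - ∑ i, p.1 i * y i ≤ w
    linarith
  -- Each `α k i` is at most 1, so capping `u` at 1 keeps feasibility; as `y ≥ 0`, it only
  -- strengthens the bound.
  have hmem : ((fun i => min (u i) 1, α) : (Fin n → ℝ) × (K → Fin n → ℝ)) ∈ knapsacks n K := by
    refine ⟨fun i => min_le_right _ _, fun k => ⟨fun i => ⟨h0 k i, le_min (h1 k i) ?_⟩, hs k⟩⟩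
    rw [← hs k]
    exact single_le_sum (f := α k) (fun i _ => h0 k i) (mem_univ i)
  have h4 := le_of_forall_extremePoints_le isCompact_knapsacks l hext _ hmem
  change ∑ k, lam k * ∑ i, α k i * a k i - ∑ i, min (u i) 1 * y i ≤ w at h4
  have h5 : ∑ i, min (u i) 1 * y i ≤ ∑ i, u i * y i :=
    sum_le_sum fun i _ => mul_le_mul_of_nonneg_right (min_le_left _ _) (hy i)
  linarith

/-! ### Splitting a point by separation -/

/-- The pairs `(W, Y)` that can be reached by splitting with values in `[-R, R]`. -/
def splits (lam : K → ℝ) (a : K → Fin n → ℝ) (R : ℝ) : Set (ℝ × (Fin n → ℝ)) :=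
  {p | ∃ v : K → ℝ, (∀ k, v k ∈ Set.Icc (-R) R) ∧ ∑ k, lam k * v k ≤ p.1 ∧
    ∀ i, ∑ k, lam k * max 0 (a k i - v k) ≤ p.2 i}

/-- The set is the projection of a closed set along a compact factor; the bound `R` on the values is
there for this compactness. -/
lemma isClosed_splits (lam : K → ℝ) (a : K → Fin n → ℝ) (R : ℝ) :
    IsClosed (splits lam a R) := by
  have hc : IsClosed {q : (K → Set.Icc (-R) R) × (ℝ × (Fin n → ℝ)) |
      ∑ k, lam k * (q.1 k : ℝ) ≤ q.2.1 ∧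
        ∀ i, ∑ k, lam k * max 0 (a k i - (q.1 k : ℝ)) ≤ q.2.2 i} := by
    simp only [Set.ofPred_and, Set.ofPred_forall]
    exact (isClosed_le (by fun_prop) (by fun_prop)).inter
      (isClosed_iInter fun i => isClosed_le (by fun_prop) (by fun_prop))
  convert isClosedMap_snd_of_compactSpace _ hc using 1
  ext p
  constructor
  · rintro ⟨v, hv, h⟩
    exact ⟨(fun k => ⟨v k, hv k⟩, p), h, rfl⟩
  · rintro ⟨⟨v, p⟩, h, rfl⟩
    exact ⟨fun k => v k, fun k => (v k).2, h⟩

lemma convex_splits {lam : K → ℝ} (hl : ∀ k, 0 ≤ lam k) (a : K → Fin n → ℝ) (R : ℝ) :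
    Convex ℝ (splits lam a R) := by
  rintro p ⟨v, hv, h1, h2⟩ p' ⟨v', hv', h1', h2'⟩ s t hs ht hst
  refine ⟨fun k => s * v k + t * v' k, fun k => ?_, ?_, fun i => ?_⟩
  · exact convex_Icc (-R) R (hv k) (hv' k) hs ht hst
  · calc ∑ k, lam k * (s * v k + t * v' k)
        = s * ∑ k, lam k * v k + t * ∑ k, lam k * v' k := by
          rw [mul_sum, mul_sum, ← sum_add_distrib]
          exact sum_congr rfl fun k _ => by ring
      _ ≤ s * p.1 + t * p'.1 := by gcongr
  · calc ∑ k, lam k * max 0 (a k i - (s * v k + t * v' k))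
        ≤ ∑ k, lam k * (s * max 0 (a k i - v k) + t * max 0 (a k i - v' k)) := by
          refine sum_le_sum fun k _ => mul_le_mul_of_nonneg_left (max_le ?_ ?_) (hl k)
          · exact add_nonneg (mul_nonneg hs (le_max_left _ _)) (mul_nonneg ht (le_max_left _ _))
          · have e : a k i - (s * v k + t * v' k) = s * (a k i - v k) + t * (a k i - v' k) := by
              linear_combination (-a k i) * hst
            rw [e]
            exact add_le_add (mul_le_mul_of_nonneg_left (le_max_right _ _) hs)
              (mul_le_mul_of_nonneg_left (le_max_right _ _) ht)
      _ = s * ∑ k, lam k * max 0 (a k i - v k) + t * ∑ k, lam k * max 0 (a k i - v' k) := by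
          rw [mul_sum, mul_sum, ← sum_add_distrib]
          exact sum_congr rfl fun k _ => by ring
      _ ≤ s * p.2 i + t * p'.2 i := by
          have := h2 i
          have := h2' i
          gcongr

lemma nonneg_of_forall_lt_add_mul {A B c : ℝ} (h : ∀ t : ℝ, 0 ≤ t → c < A + t * B) : 0 ≤ B := by
  by_contra hB
  push Not at hB
  have h0 := h 0 le_rfl
  have h1 := h ((A - c) / (-B)) (div_nonneg (by linarith) (by linarith))
  have : (A - c) / (-B) * B = c - A := by
    rw [div_mul_eq_mul_div, div_eq_iff (by linarith)]
    ring
  linarith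

/-- Nonnegative multipliers that separate a point from the closed convex set `splits`. -/
lemma exists_separating_multipliers {lam : K → ℝ} (hl : ∀ k, 0 ≤ lam k) (a : K → Fin n → ℝ)
    {R : ℝ} (hR : 0 ≤ R) {w : ℝ} {y : Fin n → ℝ} (hwy : (w, y) ∉ splits lam a R) :
    ∃ (u₀ : ℝ) (u : Fin n → ℝ), 0 ≤ u₀ ∧ (∀ i, 0 ≤ u i) ∧
      ∀ v : K → ℝ, (∀ k, v k ∈ Set.Icc (-R) R) →
        u₀ * w + ∑ i, u i * y i <
          ∑ k, lam k * (u₀ * v k + ∑ i, u i * max 0 (a k i - v k)) := by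
  classical
  obtain ⟨f, c, hf1, hf2⟩ :=
    geometric_hahn_banach_point_closed (convex_splits hl a R) (isClosed_splits lam a R) hwy
  have hf : ∀ (W : ℝ) (Y : Fin n → ℝ),
      f (W, Y) = f (1, 0) * W + ∑ i, f (0, Pi.single i 1) * Y i := by
    intro W Y
    have e : ((W, Y) : ℝ × (Fin n → ℝ)) =
        W • ((1 : ℝ), (0 : Fin n → ℝ)) + ∑ i, Y i • ((0 : ℝ), (Pi.single i 1 : Fin n → ℝ)) := by
      ext j
      · simp [Prod.fst_sum]
      · simp [Prod.snd_sum, Finset.sum_apply, Pi.single_apply]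
    rw [e, map_add, map_smul, map_sum]
    simp only [map_smul, smul_eq_mul, mul_comm]
  -- The pair reached with `v = 0`. The set is closed under increasing either component, so a
  -- functional bounded below on it has nonnegative coefficients.
  let W₀ : ℝ := ∑ k, lam k * 0
  let Y₀ : Fin n → ℝ := fun i => ∑ k, lam k * max 0 (a k i - 0)
  have hmem : ∀ (t : ℝ) (s : Fin n → ℝ), 0 ≤ t → (∀ i, 0 ≤ s i) →
      (W₀ + t, Y₀ + s) ∈ splits lam a R := fun t s ht hs =>
    ⟨fun _ => 0, fun _ => ⟨by linarith, hR⟩, le_add_of_nonneg_right ht,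
      fun i => le_add_of_nonneg_right (hs i)⟩
  refine ⟨f (1, 0), fun i => f (0, Pi.single i 1), ?_, fun i => ?_, fun v hv => ?_⟩
  · refine nonneg_of_forall_lt_add_mul (A := f (W₀, Y₀)) (c := c) fun t ht => ?_
    have := hf2 _ (hmem t 0 ht fun i => le_rfl)
    rw [add_zero, hf] at this
    rw [hf]
    linarith
  · refine nonneg_of_forall_lt_add_mul (A := f (W₀, Y₀)) (c := c) fun t ht => ?_
    have := hf2 _ (hmem 0 (Pi.single i t) le_rfl fun j => by
      rw [Pi.single_apply]; split_ifs <;> simp [ht])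
    have e : ((W₀ + 0, Y₀ + Pi.single i t) : ℝ × (Fin n → ℝ)) =
        (W₀, Y₀) + t • ((0 : ℝ), (Pi.single i 1 : Fin n → ℝ)) := by
      ext j
      · simp
      · simp [Pi.single_apply]
    rwa [e, map_add, map_smul, smul_eq_mul] at this
  · have h1 := hf2 (∑ k, lam k * v k, fun i => ∑ k, lam k * max 0 (a k i - v k))
      ⟨v, hv, le_rfl, fun i => le_rfl⟩
    have h2 := hf1.trans h1
    rw [hf w y, hf (∑ k, lam k * v k)] at h2
    refine h2.trans_eq ?_
    simp only [mul_add, sum_add_distrib, mul_sum]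
    rw [sum_comm (s := univ (α := K))]
    congr 1
    · exact sum_congr rfl fun k _ => by ring
    · exact sum_congr rfl fun i _ => sum_congr rfl fun k _ => by ring

/-- The inequalities for the vectors of `U'` allow `(w, y)` to be split. -/
lemma exists_split [NeZero n] [Nonempty K] {lam : K → ℝ} (hl : ∀ k, 0 ≤ lam k)
    (hsum : ∑ k, lam k = 1) {a : K → Fin n → ℝ} {w : ℝ} {y : Fin n → ℝ} (hy : ∀ i, 0 ≤ y i)
    (hU : ∀ u ∈ U' n, ∑ k, lam k * minCut (a k) u ≤ w + ∑ i, u i * y i) :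
    ∃ v : K → ℝ, ∑ k, lam k * v k ≤ w ∧ ∀ i, ∑ k, lam k * max 0 (a k i - v k) ≤ y i := by
  classical
  -- `R` dominates all `|a k i|`, so every positive part is resolved at `v = ±R`, and dominates
  -- `|w|` for the case `∑ u < u₀`.
  set R : ℝ := |w| + ∑ k, ∑ i, |a k i| with hRdef
  have hS : ∀ k i, |a k i| ≤ ∑ k, ∑ i, |a k i| := fun k i =>
    (single_le_sum (f := fun i => |a k i|) (fun i _ => abs_nonneg _) (mem_univ i)).trans
      (single_le_sum (f := fun k => ∑ i, |a k i|)
        (fun k _ => sum_nonneg fun i _ => abs_nonneg _) (mem_univ k))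
  have hS0 : 0 ≤ ∑ k, ∑ i, |a k i| := sum_nonneg fun k _ => sum_nonneg fun i _ => abs_nonneg _
  have hRa : ∀ k i, |a k i| ≤ R := fun k i => by linarith [hS k i, abs_nonneg w]
  have hRw : |w| ≤ R := by linarith
  have hR : 0 ≤ R := (abs_nonneg w).trans hRw
  by_contra hcon
  have hwy : (w, y) ∉ splits lam a R := fun ⟨v, _, h⟩ => hcon ⟨v, h⟩
  obtain ⟨u₀, u, hu0, hu, hsep⟩ := exists_separating_multipliers hl a hR hwy
  -- If `∑ u < u₀`, the choice `v = -R` makes all positive parts linear, and the inequalities for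
  -- the unit vectors of `U'` contradict the separation.
  rcases lt_or_ge (∑ i, u i) u₀ with hlt | hge
  · have h1 := hsep (fun _ => -R) fun _ => ⟨le_rfl, by linarith⟩
    have h2 : ∀ k i, max 0 (a k i - -R) = a k i + R := fun k i => by
      rw [sub_neg_eq_add, max_eq_right]
      linarith [(abs_le.1 (hRa k i)).1]
    have h3 : ∀ i, ∑ k, lam k * a k i ≤ w + y i := by
      intro i
      have h4 := hU _ (single_mem_U' i)
      have h5 : ∑ k, lam k * a k i ≤ ∑ k, lam k * minCut (a k) (Pi.single i 1) := by
        refine sum_le_sum fun k _ => mul_le_mul_of_nonneg_left ?_ (hl k)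
        have := sum_mul_le_minCut (a := a k) (u := Pi.single i 1) (α := Pi.single i 1)
          (fun j => (single_mem_U' i).1 j) (fun j => le_rfl) (by simp)
        simpa [Pi.single_apply] using this
      have h6 : ∑ j, (Pi.single i 1 : Fin n → ℝ) j * y j = y i := by simp [Pi.single_apply]
      linarith
    have h7 : ∑ k, lam k * (u₀ * -R + ∑ i, u i * max 0 (a k i - -R)) =
        -R * (u₀ - ∑ i, u i) + ∑ i, u i * ∑ k, lam k * a k i := by
      simp only [h2, mul_add, sum_add_distrib, ← sum_mul, mul_sum, hsum]
      rw [sum_comm (s := univ (α := K))]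
      have e1 : ∑ i, ∑ k, lam k * (u i * a k i) = ∑ i, ∑ k, u i * (lam k * a k i) :=
        sum_congr rfl fun i _ => sum_congr rfl fun k _ => by ring
      rw [e1]
      ring
    have h8 : ∑ i, u i * ∑ k, lam k * a k i ≤ ∑ i, u i * (w + y i) :=
      sum_le_sum fun i _ => mul_le_mul_of_nonneg_left (h3 i) (hu i)
    have h9 : ∑ i, u i * (w + y i) = (∑ i, u i) * w + ∑ i, u i * y i := by
      simp only [mul_add, sum_add_distrib, sum_mul]
    have h10 : -R ≤ w := (abs_le.1 hRw).1
    have h11 : -R * (u₀ - ∑ i, u i) ≤ w * (u₀ - ∑ i, u i) :=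
      mul_le_mul_of_nonneg_right h10 (by linarith)
    rw [h7] at h1
    linarith
  -- If `u₀ = 0`, the choice `v = R` kills all positive parts and leaves `uᵀy < 0`. Otherwise divide
  -- by `u₀` and take for `v` the critical values of the greedy solutions.
  rcases hu0.eq_or_lt with h0 | hpos
  · have h1 := hsep (fun _ => R) fun _ => ⟨by linarith, le_rfl⟩
    have h2 : ∀ k i, max 0 (a k i - R) = 0 := fun k i => by
      rw [max_eq_left]
      linarith [(abs_le.1 (hRa k i)).2]
    simp only [h2, ← h0, zero_mul, mul_zero, sum_const_zero, add_zero, zero_add] at h1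
    exact absurd h1 (not_lt.2 (sum_nonneg fun i _ => mul_nonneg (hu i) (hy i)))
  · have hu' : ∀ i, 0 ≤ u i / u₀ := fun i => div_nonneg (hu i) hu0
    have hge' : 1 ≤ ∑ i, u i / u₀ := by
      rw [← sum_div, le_div_iff₀ hpos, one_mul]
      exact hge
    choose α j h0 h1 h2 h3 using fun k => exists_greedy (a k) (fun i => u i / u₀) hu' hge'
    have h4 := sum_sum_mul_le_of_forall_mem_U' hl hy hU h0 h1 h2
    have h5 := hsep (fun k => a k (j k)) fun k => abs_le.1 (hRa k (j k))
    have h6 : ∀ k, u₀ * a k (j k) + ∑ i, u i * max 0 (a k i - a k (j k)) =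
        u₀ * ∑ i, α k i * a k i := by
      intro k
      rw [← h3 k, mul_add, mul_sum]
      congr 1
      exact sum_congr rfl fun i _ => by field_simp
    simp only [h6] at h5
    have h7 : ∑ k, lam k * (u₀ * ∑ i, α k i * a k i) =
        u₀ * ∑ k, lam k * ∑ i, α k i * a k i := by
      rw [mul_sum]
      exact sum_congr rfl fun k _ => by ring
    have h8 : u₀ * (w + ∑ i, u i / u₀ * y i) = u₀ * w + ∑ i, u i * y i := by
      rw [mul_add, mul_sum]
      congr 1
      exact sum_congr rfl fun i _ => by field_simp
    have h9 := mul_le_mul_of_nonneg_left h4 hu0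
    rw [h7] at h5
    linarith

/-! ### Hyperrectangles and common optimal representations -/

lemma ofInt_mono : Monotone ofInt := fun _ _ h =>
  WithBot.coe_le_coe.2 (WithTop.coe_le_coe.2 h)

lemma toEReal_mono : Monotone ExtInt.toEReal :=
  Monotone.withBot_map (Monotone.withTop_map fun _ _ h => Int.cast_le.2 h)

lemma castVec_mem_boxReal {lo hi : Fin n → ExtInt} {x : Fin n → ℤ} (hx : x ∈ box lo hi) :
    castVec x ∈ boxReal lo hi := fun i =>
  ⟨toEReal_mono (hx i).1, toEReal_mono (hx i).2⟩

lemma convex_boxReal (lo hi : Fin n → ExtInt) : Convex ℝ (boxReal lo hi) := by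
  have : boxReal lo hi = Set.univ.pi fun i =>
      ((↑) : ℝ → EReal) ⁻¹' Set.Icc (lo i).toEReal (hi i).toEReal := by
    ext x
    simp [boxReal]
  rw [this]
  exact convex_pi fun i _ => (Set.ordConnected_Icc.preimage_mono EReal.coe_strictMono.monotone).convex

lemma midUp_midDown_mem_box {lo hi : Fin n → ExtInt} {x y : Fin n → ℤ} (hx : x ∈ box lo hi)
    (hy : y ∈ box lo hi) : midUp x y ∈ box lo hi ∧ midDown x y ∈ box lo hi := by
  have key : ∀ (z : Fin n → ℤ), (∀ i, (x i ≤ z i ∧ z i ≤ y i) ∨ (y i ≤ z i ∧ z i ≤ x i)) →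
      z ∈ box lo hi := by
    intro z hz i
    rcases hz i with h | h
    · exact ⟨(hx i).1.trans (ofInt_mono h.1), (ofInt_mono h.2).trans (hy i).2⟩
    · exact ⟨(hy i).1.trans (ofInt_mono h.1), (ofInt_mono h.2).trans (hx i).2⟩
  exact ⟨key _ fun i => by rw [midUp_apply]; omega, key _ fun i => by rw [midDown_apply]; omega⟩

/-- A finite subset of a hyperrectangle lies in one that is closed under rounded midpoints. -/
lemma exists_midpoint_closed {lo hi : Fin n → ExtInt} {Z : Finset (Fin n → ℤ)}
    (hZ : ∀ z ∈ Z, z ∈ box lo hi) : ∃ Z' : Finset (Fin n → ℤ), Z ⊆ Z' ∧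
      (∀ z ∈ Z', z ∈ box lo hi) ∧ ∀ a ∈ Z', ∀ b ∈ Z', midUp a b ∈ Z' ∧ midDown a b ∈ Z' := by
  classical
  obtain ⟨t, ht⟩ := Z.bddAbove
  obtain ⟨s, hs⟩ := Z.bddBelow
  refine ⟨(Icc s t).filter (· ∈ box lo hi), fun z hz => ?_, fun z hz => (mem_filter.1 hz).2, ?_⟩
  · exact mem_filter.2 ⟨mem_Icc.2 ⟨hs hz, ht hz⟩, hZ z hz⟩
  · intro a ha b hb
    simp only [mem_filter, mem_Icc, Pi.le_def] at ha hb ⊢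
    obtain ⟨h1, h2⟩ := midUp_midDown_mem_box ha.2 hb.2
    refine ⟨⟨⟨fun i => ?_, fun i => ?_⟩, h1⟩, ⟨⟨fun i => ?_, fun i => ?_⟩, h2⟩⟩ <;>
    · have h3 := ha.1.1 i
      have h4 := ha.1.2 i
      have h5 := hb.1.1 i
      have h6 := hb.1.2 i
      first
      | rw [midUp_apply]; omega
      | rw [midDown_apply]; omega

lemma IsRep.combo {Z : Finset (Fin n → ℤ)} {x x' : Fin n → ℝ} {μ μ' : (Fin n → ℤ) → ℝ}
    (h : IsRep Z x μ) (h' : IsRep Z x' μ') {s t : ℝ} (hs : 0 ≤ s) (ht : 0 ≤ t) (hst : s + t = 1) :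
    IsRep Z (s • x + t • x') (s • μ + t • μ') where
  nonneg z := add_nonneg (mul_nonneg hs (h.nonneg z)) (mul_nonneg ht (h'.nonneg z))
  off z hz := by simp [h.off z hz, h'.off z hz]
  sum_one := by simp [sum_add_distrib, ← mul_sum, h.sum_one, h'.sum_one, hst]
  bary i := by simp [add_mul, sum_add_distrib, mul_assoc, ← mul_sum, h.bary, h'.bary]

lemma exists_isRep_of_mem_convexHull {X : Set (Fin n → ℤ)} {f : (Fin n → ℤ) → ℝ}
    {p : ℝ × (Fin n → ℝ)} (hp : p ∈ convexHull ℝ (epi X f)) :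
    ∃ (Z : Finset (Fin n → ℤ)) (ρ : (Fin n → ℤ) → ℝ), (∀ z ∈ Z, z ∈ X) ∧ IsRep Z p.2 ρ ∧
      ∑ z ∈ Z, ρ z * f z ≤ p.1 := by
  classical
  suffices h : convexHull ℝ (epi X f) ⊆ {p | ∃ (Z : Finset (Fin n → ℤ)) (ρ : (Fin n → ℤ) → ℝ),
      (∀ z ∈ Z, z ∈ X) ∧ IsRep Z p.2 ρ ∧ ∑ z ∈ Z, ρ z * f z ≤ p.1} from h hp
  refine convexHull_min ?_ ?_
  · rintro ⟨η, _⟩ ⟨z, hz, rfl, hη⟩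
    refine ⟨{z}, Pi.single z 1, by simpa using hz, ⟨fun z' => ?_, fun z' hz' => ?_, by simp,
      fun i => by simp [castVec]⟩, by simpa using hη⟩
    · rw [Pi.single_apply]; split_ifs <;> simp
    · exact Pi.single_eq_of_ne (by simpa using hz') _
  · rintro p ⟨Z, ρ, hZ, hρ, hp⟩ p' ⟨Z', ρ', hZ', hρ', hp'⟩ s t hs ht hst
    refine ⟨Z ∪ Z', s • ρ + t • ρ', fun z hz => (mem_union.1 hz).elim (hZ z) (hZ' z),
      (hρ.mono subset_union_left).combo (hρ'.mono subset_union_right) hs ht hst, ?_⟩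
    rw [← hρ.sum_mul_mono (subset_union_left (s₂ := Z'))] at hp
    rw [← hρ'.sum_mul_mono (subset_union_right (s₁ := Z))] at hp'
    calc ∑ z ∈ Z ∪ Z', (s • ρ + t • ρ') z * f z
        = s * ∑ z ∈ Z ∪ Z', ρ z * f z + t * ∑ z ∈ Z ∪ Z', ρ' z * f z := by
          simp [add_mul, sum_add_distrib, mul_assoc, ← mul_sum]
      _ ≤ s * p.1 + t * p'.1 := by gcongr

/-- The convex envelopes of all L♮-convex functions on a hyperrectangle are attained at a point by
the same convex combination. -/
lemma exists_isRep_forall_sum_le {lo hi : Fin n → ExtInt} {x : Fin n → ℝ} {η₀ : ℝ}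
    {f₀ : (Fin n → ℤ) → ℝ} (h₀ : (η₀, x) ∈ convexHull ℝ (epi (box lo hi) f₀)) :
    ∃ (Z : Finset (Fin n → ℤ)) (lam : (Fin n → ℤ) → ℝ), (∀ z ∈ Z, z ∈ box lo hi) ∧
      IsRep Z x lam ∧ ∀ (f : (Fin n → ℤ) → ℝ) (η : ℝ), LNatConvexOn (box lo hi) f →
        (η, x) ∈ convexHull ℝ (epi (box lo hi) f) → ∑ z ∈ Z, lam z * f z ≤ η := by
  classical
  obtain ⟨Z₁, ρ, hZ₁, hρ, -⟩ := exists_isRep_of_mem_convexHull h₀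
  obtain ⟨Z, hZ₁Z, hZ, hmid⟩ := exists_midpoint_closed hZ₁
  -- Taking `f = 0` gives a representation chosen before any function is; uniqueness later
  -- identifies it with the one obtained for each `f`.
  obtain ⟨lam, hlam, hadj, -⟩ := (hρ.mono hZ₁Z).exists_adjacentSupport hmid (f := 0)
    fun _ _ _ _ => by simp
  refine ⟨Z, lam, hZ, hlam, fun f η hf hη => ?_⟩
  obtain ⟨Z₂, ρ', hZ₂, hρ', hle⟩ := exists_isRep_of_mem_convexHull hη
  obtain ⟨Z', hZ₂Z', hZ', hmid'⟩ := exists_midpoint_closed hZ₂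
  obtain ⟨μ, hμ, hadj', hle'⟩ := (hρ'.mono hZ₂Z').exists_adjacentSupport hmid' (f := f)
    fun a ha b hb => hf a (hZ' a ha) b (hZ' b hb)
  have heq : lam = μ := (hlam.mono (subset_union_left (s₂ := Z'))).eq_of_adjacentSupport
    (hμ.mono (subset_union_right (s₁ := Z))) hadj hadj'
  rw [hρ'.sum_mul_mono hZ₂Z'] at hle'
  rw [← hlam.sum_mul_mono (subset_union_left (s₂ := Z')), heq,
    hμ.sum_mul_mono (subset_union_right (s₁ := Z))]
  exact hle'.trans hle

/-! ### The two inclusions -/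

lemma convex_CP' [NeZero n] (lo hi : Fin n → ExtInt) (h : Fin n → (Fin n → ℤ) → ℝ) :
    Convex ℝ (CP' lo hi h) := by
  rintro p ⟨hp1, hp2, hp3⟩ q ⟨hq1, hq2, hq3⟩ s t hs ht hst
  refine ⟨fun i => add_nonneg (mul_nonneg hs (hp1 i)) (mul_nonneg ht (hq1 i)),
    convex_boxReal lo hi hp2 hq2 hs ht hst, fun u hu => ?_⟩
  convert convex_convexHull ℝ (epi (box lo hi) (F h 1 u)) (hp3 u hu) (hq3 u hu) hs ht hst using 1
  ext i
  · simp only [Prod.fst_add, Prod.smul_fst, Prod.snd_add, Prod.smul_snd, Pi.add_apply,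
      Pi.smul_apply, smul_eq_mul, mul_add, mul_sum, sum_add_distrib]
    have e : ∀ (c : ℝ) (y : Fin n → ℝ), ∑ i, u i * (c * y i) = ∑ i, c * (u i * y i) :=
      fun c y => sum_congr rfl fun i _ => by ring
    rw [e, e]
    ring
  · simp

lemma epiH_subset_CP' [NeZero n] (lo hi : Fin n → ExtInt) (h : Fin n → (Fin n → ℤ) → ℝ) :
    epiH (box lo hi) h ⊆ CP' lo hi h := by
  rintro ⟨w, y, _⟩ ⟨hy, x, hx, rfl, hH⟩
  refine ⟨hy, castVec_mem_boxReal hx, fun u hu => subset_convexHull ℝ _ ⟨x, hx, rfl, ?_⟩⟩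
  dsimp only at hy hH ⊢
  have hw : ∀ i, h i x ≤ w + y i := fun i => by
    have : h i x - y i ≤ H h x y := le_sup' (fun i => h i x - y i) (mem_univ i)
    linarith
  obtain ⟨α, j, h0, h1, h2, h3⟩ := exists_greedy (fun i => h i x) u hu.1 (one_le_sum_of_mem_U' hu)
  calc F h 1 u x = minCut (fun i => h i x) u := F_one_eq_minCut h u x
    _ ≤ h j x + ∑ i, u i * max 0 (h i x - h j x) := minCut_le (fun i => h i x) u j
    _ = ∑ i, α i * h i x := h3
    _ ≤ ∑ i, α i * (w + y i) := sum_le_sum fun i _ => mul_le_mul_of_nonneg_left (hw i) (h0 i)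
    _ = w + ∑ i, α i * y i := by simp [mul_add, sum_add_distrib, ← sum_mul, h2]
    _ ≤ w + ∑ i, u i * y i := by
        gcongr with i _
        · exact hy i
        · exact h1 i

lemma CP'_subset_convexHull_epiH [NeZero n] (lo hi : Fin n → ExtInt)
    (h : Fin n → (Fin n → ℤ) → ℝ)
    (hF : ∀ u ∈ U' n, LNatConvexOn (box lo hi) (F h 1 u)) :
    CP' lo hi h ⊆ convexHull ℝ (epiH (box lo hi) h) := by
  classical
  rintro ⟨w, y, x⟩ ⟨hy, -, hp⟩
  dsimp only at hy hp
  -- The unit vector serves only to show that `x` is a convex combination of points of the box.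
  obtain ⟨Z, lam, hZ, hlam, hle⟩ := exists_isRep_forall_sum_le (hp _ (single_mem_U' 0))
  have hsum : ∑ k : Z, lam k = 1 := by rw [sum_coe_sort Z lam, hlam.sum_one]
  have : Nonempty Z := by
    by_contra hne
    rw [not_nonempty_iff] at hne
    rw [univ_eq_empty, sum_empty] at hsum
    exact zero_ne_one hsum
  obtain ⟨v, hv1, hv2⟩ := exists_split (K := Z) (lam := fun k => lam k)
    (a := fun k i => h i k) (fun k => hlam.nonneg k) hsum hy (w := w) fun u hu => by
      have := hle (F h 1 u) _ (hF u hu) (hp u hu)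
      rw [← sum_coe_sort] at this
      simpa only [F_one_eq_minCut] using this
  -- The slacks left by the split are added equally to all points, so that their mean is exactly
  -- `(w, y, x)`.
  let P : Z → ℝ × (Fin n → ℝ) × (Fin n → ℝ) := fun k =>
    (v k + (w - ∑ k : Z, lam k * v k),
      fun i => max 0 (h i k - v k) + (y i - ∑ k : Z, lam k * max 0 (h i k - v k)), castVec k)
  have hP : ∀ k, P k ∈ epiH (box lo hi) h := by
    intro k
    refine ⟨fun i => ?_, k, hZ k k.2, rfl, sup'_le _ _ fun i _ => ?_⟩
    · have := hv2 i
      have := le_max_left 0 (h i k - v k)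
      dsimp only [P]
      linarith
    · have := hv2 i
      have := le_max_right 0 (h i k - v k)
      dsimp only [P]
      linarith
  have hmem := (convex_convexHull ℝ (epiH (box lo hi) h)).sum_mem (t := univ)
    (w := fun k : Z => lam k) (fun k _ => hlam.nonneg k) hsum
    fun k _ => subset_convexHull ℝ _ (hP k)
  convert hmem using 1
  ext i
  · simp [-univ_eq_attach, P, Prod.fst_sum, mul_add, sum_add_distrib, ← sum_mul, hsum]
  · simp [-univ_eq_attach, P, Prod.fst_sum, Prod.snd_sum, mul_add, sum_add_distrib, ← sum_mul, hsum]
  · have := hlam.bary i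
    rw [← sum_coe_sort] at this
    simp [-univ_eq_attach, P, Prod.snd_sum, castVec, this]

end MixedLNat

theorem mainTheorem5 (n : ℕ) [NeZero n] (lo hi : Fin n → MixedLNat.ExtInt)
    (h : Fin n → (Fin n → ℤ) → ℝ)
    (hh : ∀ j, MixedLNat.LNatConvexOn (MixedLNat.box lo hi) (h j))
    (hg : ∀ i j, MixedLNat.LNatConvexOn (MixedLNat.box lo hi) (MixedLNat.g h j i))
    (hF : ∀ (u₀ : ℝ) (u : Fin n → ℝ), (u₀, u) ∈ MixedLNat.U n →
      MixedLNat.LNatConvexOn (MixedLNat.box lo hi) (MixedLNat.F h u₀ u)) :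
    (MixedLNat.U' n).Finite ∧
      convexHull ℝ (MixedLNat.epiH (MixedLNat.box lo hi) h) = MixedLNat.CP' lo hi h :=
  ⟨MixedLNat.finite_U', (convexHull_min (MixedLNat.epiH_subset_CP' lo hi h)
    (MixedLNat.convex_CP' lo hi h)).antisymm
      (MixedLNat.CP'_subset_convexHull_epiH lo hi h fun u hu =>
        hF 1 u ⟨zero_le_one, hu.1, MixedLNat.one_le_sum_of_mem_U' hu⟩)⟩
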